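/- Consider a CSMA network with energy harvesting. Packets of duration $L>0$ arrive in the plane according to a space-time Poisson process with intensity $\lambda/L$ per unit area and unit time ($\lambda>0$), each packet having its own transmitter. A typical transmitter is at distance $d>0$ from its receiver; fading is independent Rayleigh, the path-loss exponent is $\alpha>2$, noise is neglected, and all transmitters use unit power. The typical transmitter backs off at time $0$ unless its signal-to-interference ratio $\mathsf{SIR}$ exceeds the threshold $\theta>0$; the interference comes from the other packets that arrived in $(-L,0]$ and whose transmitters were not in back-off and had energy. Back-offs are assumed independent: each other transmitter is in back-off with probability $P_b$ and has energy with probability $r$, where these indicators, the fading coefficients and the packet arrivals are all independent. Here $r=\lim_{t\to\infty}P(E(t)\ge 1)$ for the energy queue with infinite battery on $\{0,1,2,\dots\}$ that gains one unit with probability $p\in(0,1]$ in each slot and, when $E(t)\ge 1$, spends one unit with probability $1-P_b$, independently. The back-off probability $P_b$ is self-consistent: $P_b=P(\mathsf{SIR}\le\theta)$. Put $$\kappa(\alpha)=\frac{2\pi^2}{\alpha\sin(2\pi/\alpha)},\qquad \lambda_{\max}=\frac{1}{d^2\,\theta^{2/\alpha}\,\kappa(\alpha)} .$$ Then: 1.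 If $\dfrac{-\lambda_{\max}\ln p}{\lambda}>p$, then $P_b=1-\exp\left(-\dfrac{p\,\lambda}{\lambda_{\max}}\right)$. 2. Otherwise $P_b$ satisfies $P_b=1-\exp\left(-\dfrac{\lambda(1-P_b)}{\lambda_{\max}}\right)$, and the only real solution of this equation is $P_b=1-\dfrac{\lambda_{\max}}{\lambda}\,W_0\!\left(\dfrac{\lambda}{\lambda_{\max}}\right)$, where $W_0$ is the principal real branch of Lambert's function. -/

import Mathlib

open MeasureTheory ProbabilityTheory Filter Topology

noncomputable section

namespace EnergyCSMA

/-! ### Poisson point processes -/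

/-- The number of indices `m` with `X m ω ∈ B`: the counting measure of the random points
`X 0, X 1, …` evaluated at `B`. -/
def pointCount {Ω S : Type*} [MeasurableSpace S] (X : ℕ → Ω → S) (B : Set S) (ω : Ω) : ENNReal :=
  Measure.sum (fun m => Measure.dirac (X m ω)) B

/-- The random points `X 0, X 1, …` form a Poisson point process with intensity measure `Λ`:
the number of points in a set `B` of finite intensity is Poisson distributed with mean `Λ B`, and
the numbers of points in finitely many pairwise disjoint such sets are independent. -/
structure IsPoissonPointProcess {Ω S : Type*} [MeasurableSpace Ω] [MeasurableSpace S]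
    (X : ℕ → Ω → S) (Λ : Measure S) (P : Measure Ω) : Prop where
  measurable : ∀ m, Measurable (X m)
  count_law : ∀ B : Set S, MeasurableSet B → Λ B ≠ ⊤ →
    HasLaw (pointCount X B) ((poissonMeasure (Λ B).toNNReal).map (Nat.cast : ℕ → ENNReal)) P
  indep_count : ∀ (n : ℕ) (B : Fin n → Set S), (∀ i, MeasurableSet (B i)) → (∀ i, Λ (B i) ≠ ⊤) →
    Pairwise (fun i j => Disjoint (B i) (B j)) → iIndepFun (fun i => pointCount X (B i)) P

/-! ### Energy queue with an infinite battery -/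

/-- Transition probabilities of the energy level: in each slot one unit of energy arrives with
probability `p`, and, if the level is at least `1`, one unit is spent with probability `q`. -/
def energyStep (p q : ℝ) (i j : ℕ) : ℝ :=
  if i = 0 then
    if j = 1 then p else if j = 0 then 1 - p else 0
  else
    if j = i + 1 then p * (1 - q)
    else if j + 1 = i then q * (1 - p)
    else if j = i then p * q + (1 - p) * (1 - q)
    else 0

/-- `energyLaw p q e₀ t k` is the probability that the energy level at time `t` is `k`, when the
battery starts at level `e₀`. -/
def energyLaw (p q : ℝ) (e₀ : ℕ) : ℕ → ℕ → ℝ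
  | 0, k => if k = e₀ then 1 else 0
  | t + 1, k => ∑' i, energyLaw p q e₀ t i * energyStep p q i k

/-- `r` is the steady-state probability that the energy level is at least `1`. -/
def IsEnergyAvailability (p q : ℝ) (e₀ : ℕ) (r : ℝ) : Prop :=
  Tendsto (fun t => ∑' k, energyLaw p q e₀ t (k + 1)) atTop (𝓝 r)

/-! ### Fading -/

/-- The Rayleigh distribution with scale `s`. -/
def rayleigh (s : ℝ) : Measure ℝ :=
  volume.withDensity fun x =>
    ENNReal.ofReal (if 0 ≤ x then x / s ^ 2 * Real.exp (-x ^ 2 / (2 * s ^ 2)) else 0)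

/-! ### The CSMA network -/

/-- The Euclidean plane. -/
abbrev Plane := EuclideanSpace ℝ (Fin 2)

/-- A CSMA network seen from a typical transmitter-receiver pair at time `0`. The other packets are
numbered by `ℕ`; each has its own transmitter. -/
structure Network (Ω : Type*) where
  /-- location of the typical transmitter -/
  tx : Plane
  /-- location of the typical receiver -/
  rx : Plane
  /-- transmitter location and arrival time of packet `m` -/
  packet : ℕ → Ω → Plane × ℝ
  /-- the transmitter of packet `m` is not in back-off -/
  clear : ℕ → Ω → Bool
  /-- the transmitter of packet `m` has at least one unit of energy -/
  charged : ℕ → Ω → Bool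
  /-- modulus of the fading coefficient from the transmitter of packet `m` to the typical
  receiver -/
  fade : ℕ → Ω → ℝ
  /-- modulus of the fading coefficient between the typical transmitter and its receiver -/
  fade₀ : Ω → ℝ

namespace Network

variable {Ω : Type*} (N : Network Ω)

open Classical in
/-- Power received at the typical receiver, at time `0`, from packet `m`: a packet of duration `L`
is on air at time `0` if it arrived in `(-L, 0]`, its transmitter was not in back-off and it had
energy. -/
def receivedPower (L α : ℝ) (m : ℕ) (ω : Ω) : ENNReal :=
  if (N.packet m ω).2 ∈ Set.Ioc (-L) 0 ∧ N.clear m ω = true ∧ N.charged m ω = true then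
    ENNReal.ofReal (dist N.rx (N.packet m ω).1 ^ (-α) * N.fade m ω ^ 2)
  else 0

/-- Signal-to-interference ratio of the typical pair at time `0`, in `[0, ∞]`; it is `∞` if there
is signal and no interference. -/
def SIR (L α : ℝ) (ω : Ω) : ENNReal :=
  ENNReal.ofReal (dist N.tx N.rx ^ (-α) * N.fade₀ ω ^ 2) / ∑' m, N.receivedPower L α m ω

/-- The typical transmitter backs off: the channel is not sensed idle, i.e. `SIR > θ` fails. -/
def backoffEvent (L α θ : ℝ) : Set Ω :=
  {ω | ¬ ENNReal.ofReal θ < N.SIR L α ω}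

/-- The laws of the model with independent back-offs, when every other transmitter is in back-off
with probability `b` and has energy with probability `r`. Packets arrive at rate `lam / L` per unit
area and unit time; back-off indicators, energy indicators and Rayleigh fading coefficients are
independent of each other, across transmitters, and of the packet arrivals. -/
structure HasIndependentBackoffs [MeasurableSpace Ω] (P : Measure Ω) (lam L d s : ℝ)
    (b r : unitInterval) : Prop where
  dist_pair : dist N.tx N.rx = d
  packets : IsPoissonPointProcess N.packet (ENNReal.ofReal (lam / L) • volume) P
  measurable_clear : ∀ m, Measurable (N.clear m)
  measurable_charged : ∀ m, Measurable (N.charged m)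
  measurable_fade : ∀ m, Measurable (N.fade m)
  measurable_fade₀ : Measurable N.fade₀
  /-- back-off, energy and fading of one transmitter are independent, with the stated laws -/
  mark_law : ∀ m, HasLaw (fun ω => (N.clear m ω, N.charged m ω, N.fade m ω))
    ((bernoulliMeasure true false (unitInterval.symm b)).prod
      ((bernoulliMeasure true false r).prod (rayleigh s))) P
  fade₀_law : HasLaw N.fade₀ (rayleigh s) P
  /-- independence across transmitters -/
  indep_marks : iIndepFun (fun m ω => (N.clear m ω, N.charged m ω, N.fade m ω)) P
  /-- independence of arrivals and marks -/
  indep_packets : IndepFun (fun ω m => N.packet m ω)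
    (fun ω m => (N.clear m ω, N.charged m ω, N.fade m ω)) P
  /-- independence of the typical link from everything else -/
  indep_fade₀ : IndepFun N.fade₀
    (fun ω => ((fun m => N.packet m ω),
      fun m => (N.clear m ω, N.charged m ω, N.fade m ω))) P

/-- `b` is the back-off probability of the CSMA network with energy arrival rate `p` and infinite
batteries: under independent back-offs, when every other transmitter is in back-off with
probability `b` and has energy with the steady-state probability of an energy queue whose access
probability is `1 - b`, the typical transmitter is in back-off with the same probability `b`. -/
def IsBackoffProbability [MeasurableSpace Ω] (P : Measure Ω) (lam L d s α θ p : ℝ) (e₀ : ℕ)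
    (b : unitInterval) : Prop :=
  ∃ r : unitInterval, IsEnergyAvailability p (1 - b) e₀ r ∧
    N.HasIndependentBackoffs P lam L d s b r ∧
    P.real (N.backoffEvent L α θ) = b

end Network

/-! ### Constants -/

/-- `κ(α) = 2π² / (α sin(2π/α))`. -/
def kappa (α : ℝ) : ℝ := 2 * Real.pi ^ 2 / (α * Real.sin (2 * Real.pi / α))

/-- `λ_max = 1 / (d² θ^(2/α) κ(α))`. -/
def lamMax (d θ α : ℝ) : ℝ := 1 / (d ^ 2 * θ ^ (2 / α) * kappa α)

/-- The principal real branch `W₀` of Lambert's function: for `y ≥ -1/e`, the unique `w ≥ -1` with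
`w * exp w = y`. -/
def lambertW₀ (y : ℝ) : ℝ := Function.invFunOn (fun w : ℝ => w * Real.exp w) (Set.Ici (-1)) y

end EnergyCSMA

end

/-!
Given `b`, thinning the Poisson packets by the independent indicators and averaging over the
Rayleigh fading, the Laplace functional of a marked Poisson process evaluates the Laplace transform
of the interference. Since the squared modulus of the fading on the typical link is exponential,
that transform is also the tail of the SIR, so the success probability is
`exp (-λ (1 - b) r / λ_max)`.

The availability `r` need only be known through `q r`, the rate at which energy is spent when the
access probability is `q = 1 - b`. The drift of the level gives `q r ≤ p`, the drift of `z ^ level`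
as `z ↑ 1` gives `q (1 - r) ≤ max (q - p) 0`, and together `q r = min p q`.

Hence `x = 1 - b` satisfies `x = f (min p x)` for the antitone function `f x = exp (-λ x / λ_max)`.
If `p < f p` the minimum is `p`, otherwise it is `x`, and then `x = f x` is solved by Lambert's
function.
-/

namespace EnergyCSMA

open scoped ENNReal

/-! ### The energy queue -/

theorem energyLaw_eq_zero_of_lt (p q : ℝ) (e₀ : ℕ) :
    ∀ t k : ℕ, e₀ + t < k → energyLaw p q e₀ t k = 0
  | 0, k, h => by rw [energyLaw, if_neg (by omega)]
  | t + 1, k, h => by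
    rw [energyLaw]
    refine (tsum_congr fun i => ?_).trans tsum_zero
    rcases lt_or_ge (e₀ + t) i with hi | hi
    · rw [energyLaw_eq_zero_of_lt p q e₀ t i hi, zero_mul]
    · have hstep : energyStep p q i k = 0 := by
        unfold energyStep
        split_ifs <;> first | rfl | omega
      rw [hstep, mul_zero]

/-- Expectation of a function of the energy level at time `t`, as a linear functional. The level is
at most `e₀ + t`, so a finite sum suffices. -/
noncomputable def energyMean (p q : ℝ) (e₀ t : ℕ) : (ℕ → ℝ) →ₗ[ℝ] ℝ :=
  ∑ k ∈ Finset.range (e₀ + t + 1), energyLaw p q e₀ t k • LinearMap.proj k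

theorem energyMean_apply (p q : ℝ) (e₀ t : ℕ) (f : ℕ → ℝ) :
    energyMean p q e₀ t f = ∑ k ∈ Finset.range (e₀ + t + 1), energyLaw p q e₀ t k * f k := by
  simp [energyMean]

/-- Transition operator of the energy queue: `energyOp p q f i` is the expectation of `f` of the
next energy level when the current level is `i`. -/
def energyOp (p q : ℝ) (f : ℕ → ℝ) : ℕ → ℝ
  | 0 => p * f 1 + (1 - p) * f 0
  | i + 1 => p * (1 - q) * f (i + 2) + q * (1 - p) * f i
      + (p * q + (1 - p) * (1 - q)) * f (i + 1)

theorem sum_energyStep_mul (p q : ℝ) (f : ℕ → ℝ) {i n : ℕ} (h : i + 1 < n) :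
    ∑ k ∈ Finset.range n, energyStep p q i k * f k = energyOp p q f i := by
  cases i with
  | zero =>
    have hterm (k : ℕ) : energyStep p q 0 k * f k
        = (if k = 1 then p * f k else 0) + (if k = 0 then (1 - p) * f k else 0) := by
      unfold energyStep
      split_ifs <;> first | omega | simp
    simp_rw [hterm, Finset.sum_add_distrib, Finset.sum_ite_eq', Finset.mem_range]
    rw [if_pos (by omega), if_pos (by omega), energyOp]
  | succ m =>
    have hterm (k : ℕ) : energyStep p q (m + 1) k * f k
        = (if k = m + 2 then p * (1 - q) * f k else 0) + (if k = m then q * (1 - p) * f k else 0)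
          + (if k = m + 1 then (p * q + (1 - p) * (1 - q)) * f k else 0) := by
      unfold energyStep
      rw [if_neg (Nat.succ_ne_zero m)]
      simp only [Nat.add_right_cancel_iff, add_assoc, Nat.reduceAdd]
      split_ifs <;> first | omega | simp
    simp_rw [hterm, Finset.sum_add_distrib, Finset.sum_ite_eq', Finset.mem_range]
    rw [if_pos (by omega), if_pos (by omega), if_pos (by omega), energyOp]

theorem energyLaw_succ_eq_sum (p q : ℝ) (e₀ t k : ℕ) :
    energyLaw p q e₀ (t + 1) k
      = ∑ i ∈ Finset.range (e₀ + t + 1), energyLaw p q e₀ t i * energyStep p q i k := by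
  rw [energyLaw]
  refine tsum_eq_sum fun i hi => ?_
  rw [energyLaw_eq_zero_of_lt p q e₀ t i (by simpa using hi), zero_mul]

theorem energyMean_succ (p q : ℝ) (e₀ t : ℕ) (f : ℕ → ℝ) :
    energyMean p q e₀ (t + 1) f = energyMean p q e₀ t (energyOp p q f) := by
  simp_rw [energyMean_apply, energyLaw_succ_eq_sum, Finset.sum_mul]
  rw [Finset.sum_comm]
  refine Finset.sum_congr rfl fun i hi => ?_
  rw [← sum_energyStep_mul p q f (n := e₀ + (t + 1) + 1)
    (by have := Finset.mem_range.1 hi; omega), Finset.mul_sum]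
  exact Finset.sum_congr rfl fun k _ => mul_assoc _ _ _

theorem energyOp_one (p q : ℝ) : energyOp p q 1 = 1 := by
  funext i
  cases i <;> simp only [energyOp, Pi.one_apply] <;> ring

theorem energyMean_one (p q : ℝ) (e₀ : ℕ) : ∀ t, energyMean p q e₀ t 1 = 1
  | 0 => by simp [energyMean_apply, energyLaw]
  | t + 1 => by rw [energyMean_succ, energyOp_one, energyMean_one p q e₀ t]

theorem energyMean_single_zero (p q : ℝ) (e₀ t : ℕ) :
    energyMean p q e₀ t (Pi.single 0 1) = energyLaw p q e₀ t 0 := by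
  simp [energyMean_apply, Pi.single_apply]

theorem tsum_energyLaw_succ (p q : ℝ) (e₀ t : ℕ) :
    ∑' k, energyLaw p q e₀ t (k + 1) = 1 - energyLaw p q e₀ t 0 := by
  have hone := energyMean_one p q e₀ t
  simp only [energyMean_apply, Pi.one_apply, mul_one, Finset.sum_range_succ'] at hone
  rw [← hone, add_sub_cancel_right]
  refine tsum_eq_sum fun k hk => energyLaw_eq_zero_of_lt p q e₀ t _ ?_
  exact Nat.lt_succ_of_le (by simpa using hk)

theorem nonneg_of_tendsto_of_le_sum_range {u : ℕ → ℝ} {l C : ℝ} (hu : Tendsto u atTop (𝓝 l))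
    (hC : ∀ n, C ≤ ∑ i ∈ Finset.range n, u i) : 0 ≤ l := by
  have hzero : Tendsto (fun n : ℕ => (n : ℝ)⁻¹ * C) atTop (𝓝 0) := by
    simpa using (tendsto_inv_atTop_nhds_zero_nat (𝕜 := ℝ)).mul_const C
  exact le_of_tendsto_of_tendsto' hzero hu.cesaro fun n =>
    mul_le_mul_of_nonneg_left (hC n) (by positivity)

section SteadyState

variable {p q r : ℝ} {e₀ : ℕ}

theorem energyStep_nonneg (hp : p ∈ Set.Icc 0 1) (hq : q ∈ Set.Icc 0 1) (i j : ℕ) :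
    0 ≤ energyStep p q i j := by
  have := hp.1
  have := hq.1
  have := sub_nonneg.2 hp.2
  have := sub_nonneg.2 hq.2
  unfold energyStep
  split_ifs <;> positivity

theorem energyLaw_nonneg (hp : p ∈ Set.Icc 0 1) (hq : q ∈ Set.Icc 0 1) (e₀ : ℕ) :
    ∀ t k : ℕ, 0 ≤ energyLaw p q e₀ t k
  | 0, k => by rw [energyLaw]; split_ifs <;> norm_num
  | t + 1, k => by
    rw [energyLaw]
    exact tsum_nonneg fun i =>
      mul_nonneg (energyLaw_nonneg hp hq e₀ t i) (energyStep_nonneg hp hq i k)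

theorem energyMean_mono (hp : p ∈ Set.Icc 0 1) (hq : q ∈ Set.Icc 0 1) (e₀ t : ℕ) :
    Monotone (energyMean p q e₀ t) := fun f g h => by
  simp_rw [energyMean_apply]
  exact Finset.sum_le_sum fun k _ =>
    mul_le_mul_of_nonneg_left (h k) (energyLaw_nonneg hp hq e₀ t k)

namespace IsEnergyAvailability

theorem tendsto_energyLaw_zero (h : IsEnergyAvailability p q e₀ r) :
    Tendsto (fun t => energyLaw p q e₀ t 0) atTop (𝓝 (1 - r)) := by
  have hsum : Tendsto _ _ _ := h
  simp_rw [tsum_energyLaw_succ] at hsum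
  simpa using hsum.const_sub 1

theorem le_one (h : IsEnergyAvailability p q e₀ r) (hp : p ∈ Set.Icc 0 1)
    (hq : q ∈ Set.Icc 0 1) : r ≤ 1 :=
  sub_nonneg.1 (ge_of_tendsto' h.tendsto_energyLaw_zero fun t => energyLaw_nonneg hp hq e₀ t 0)

/- Foster–Lyapunov argument: the mean of `f` moves by at most `a - c * P(E(t) = 0)` in slot `t`, and
it is bounded below, so the Cesàro limit `a - c * (1 - r)` of these increments is nonnegative. -/
theorem mul_one_sub_le_of_drift (h : IsEnergyAvailability p q e₀ r) (hp : p ∈ Set.Icc 0 1)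
    (hq : q ∈ Set.Icc 0 1) {f : ℕ → ℝ} {C a c : ℝ} (hf : ∀ k, C ≤ f k)
    (hdrift : ∀ k, energyOp p q f k ≤ f k + (a - c * (Pi.single 0 1 : ℕ → ℝ) k)) :
    c * (1 - r) ≤ a := by
  have hstep (t : ℕ) : energyMean p q e₀ (t + 1) f - energyMean p q e₀ t f
      ≤ a - c * energyLaw p q e₀ t 0 := by
    have := energyMean_mono hp hq e₀ t
      (show energyOp p q f ≤ f + (a • 1 - c • Pi.single 0 1) from fun k => by simpa using hdrift k)
    rw [← energyMean_succ, map_add, map_sub, map_smul, map_smul, energyMean_one,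
      energyMean_single_zero, smul_eq_mul, smul_eq_mul, mul_one] at this
    linarith
  have hbelow (t : ℕ) : C ≤ energyMean p q e₀ t f := by
    have := energyMean_mono hp hq e₀ t (show C • 1 ≤ f from fun k => by simpa using hf k)
    rwa [map_smul, energyMean_one, smul_eq_mul, mul_one] at this
  refine sub_nonneg.1 (nonneg_of_tendsto_of_le_sum_range (C := C - energyMean p q e₀ 0 f)
    ((h.tendsto_energyLaw_zero.const_mul c).const_sub a) fun n => ?_)
  refine le_trans ?_ (Finset.sum_le_sum fun t _ => hstep t)
  rw [Finset.sum_range_sub fun t => energyMean p q e₀ t f]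
  exact sub_le_sub_right (hbelow n) _

theorem mul_le (h : IsEnergyAvailability p q e₀ r) (hp : p ∈ Set.Icc 0 1)
    (hq : q ∈ Set.Icc 0 1) : q * r ≤ p := by
  have hidle := h.mul_one_sub_le_of_drift hp hq (f := fun k => k) (a := p - q) (c := -q)
    (fun k => Nat.cast_nonneg k) fun k => by
      cases k <;> (simp only [energyOp, Pi.single_apply, Nat.add_eq_zero_iff, one_ne_zero,
        and_false, if_true, if_false]; push_cast; linarith)
  linarith

/- Drift of the Lyapunov function `z ^ (k + 1) / (1 - z)`, which for `z` close to `1` behaves like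
`-k` up to a constant but is bounded below. -/
theorem mul_one_sub_le_max_of_mem_Ioo (h : IsEnergyAvailability p q e₀ r) (hp : p ∈ Set.Icc 0 1)
    (hq : q ∈ Set.Icc 0 1) {z : ℝ} (hz : z ∈ Set.Ioo 0 1) :
    q * (1 - p + p * z) * (1 - r) ≤ max (q - p * z - p * q * (1 - z)) 0 := by
  obtain ⟨hz₀, hz₁⟩ := hz
  have : 0 < 1 - z := sub_pos.2 hz₁
  refine h.mul_one_sub_le_of_drift hp hq (f := fun k => z ^ (k + 1) / (1 - z)) (C := 0)
    (fun k => by positivity) fun k => ?_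
  calc energyOp p q (fun k => z ^ (k + 1) / (1 - z)) k
      = z ^ (k + 1) / (1 - z) + ((q - p * z - p * q * (1 - z)) * z ^ k
          - q * (1 - p + p * z) * (Pi.single 0 1 : ℕ → ℝ) k) := by
        cases k <;> (simp only [energyOp, Pi.single_apply, Nat.add_eq_zero_iff, one_ne_zero,
          and_false, if_true, if_false]; field_simp; ring)
    _ ≤ _ := by
        gcongr
        calc (q - p * z - p * q * (1 - z)) * z ^ k
            ≤ max (q - p * z - p * q * (1 - z)) 0 * z ^ k := by gcongr; exact le_max_left _ _
          _ ≤ max (q - p * z - p * q * (1 - z)) 0 :=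
            mul_le_of_le_one_right (le_max_right _ _) (pow_le_one₀ hz₀.le hz₁.le)

theorem mul_one_sub_le_max (h : IsEnergyAvailability p q e₀ r) (hp : p ∈ Set.Icc 0 1)
    (hq : q ∈ Set.Icc 0 1) : q * (1 - r) ≤ max (q - p) 0 := by
  have hleft : Tendsto (fun z : ℝ => q * (1 - p + p * z) * (1 - r)) (𝓝[<] 1)
      (𝓝 (q * (1 - p + p * 1) * (1 - r))) :=
    Continuous.tendsto (f := fun z : ℝ => q * (1 - p + p * z) * (1 - r)) (by fun_prop) 1
      |>.mono_left nhdsWithin_le_nhds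
  have hright : Tendsto (fun z : ℝ => max (q - p * z - p * q * (1 - z)) 0) (𝓝[<] 1)
      (𝓝 (max (q - p * 1 - p * q * (1 - 1)) 0)) :=
    Continuous.tendsto (f := fun z : ℝ => max (q - p * z - p * q * (1 - z)) 0) (by fun_prop) 1
      |>.mono_left nhdsWithin_le_nhds
  have hle := le_of_tendsto_of_tendsto hleft hright <| by
    filter_upwards [Ioo_mem_nhdsLT (zero_lt_one (α := ℝ))] with z hz
    exact h.mul_one_sub_le_max_of_mem_Ioo hp hq hz
  simpa using hle

theorem mul_eq_min (h : IsEnergyAvailability p q e₀ r) (hp : p ∈ Set.Icc 0 1)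
    (hq : q ∈ Set.Icc 0 1) : q * r = min p q := by
  refine le_antisymm (le_min (h.mul_le hp hq) (mul_le_of_le_one_right hq.1 (h.le_one hp hq))) ?_
  have hidle := h.mul_one_sub_le_max hp hq
  rcases le_total p q with hpq | hpq
  · rw [max_eq_left (by linarith)] at hidle
    rw [min_eq_left hpq]; linarith
  · rw [max_eq_right (by linarith)] at hidle
    rw [min_eq_right hpq]; linarith

end IsEnergyAvailability

end SteadyState

/-! ### The function `exp (-x)` on `[0, ∞]` -/

/-- The function `exp (-x)` on `[0, ∞]`, with value `0` at `∞`; it turns sums of powers, which may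
be infinite, into Laplace transforms. -/
noncomputable def expNeg (x : ℝ≥0∞) : ℝ≥0∞ := EReal.exp (-(x : EReal))

theorem continuous_expNeg : Continuous expNeg :=
  ENNReal.continuous_exp.comp (continuous_neg.comp continuous_coe_ennreal_ereal)

@[fun_prop]
theorem measurable_expNeg : Measurable expNeg := continuous_expNeg.measurable

theorem expNeg_antitone : Antitone expNeg := fun _ _ h =>
  EReal.exp_monotone (EReal.neg_le_neg_iff.2 (EReal.coe_ennreal_le_coe_ennreal_iff.2 h))

@[simp]
theorem expNeg_zero : expNeg 0 = 1 := by simp [expNeg]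

@[simp]
theorem expNeg_top : expNeg ⊤ = 0 := by simp [expNeg]

theorem expNeg_le_one (x : ℝ≥0∞) : expNeg x ≤ 1 :=
  expNeg_zero ▸ expNeg_antitone zero_le

theorem expNeg_ne_top (x : ℝ≥0∞) : expNeg x ≠ ⊤ :=
  ne_top_of_le_ne_top ENNReal.one_ne_top (expNeg_le_one x)

theorem expNeg_add (x y : ℝ≥0∞) : expNeg (x + y) = expNeg x * expNeg y := by
  rw [expNeg, EReal.coe_ennreal_add, EReal.neg_add (by simp) (by simp), sub_eq_add_neg,
    EReal.exp_add, expNeg, expNeg]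

theorem expNeg_ofReal {x : ℝ} (hx : 0 ≤ x) :
    expNeg (ENNReal.ofReal x) = ENNReal.ofReal (Real.exp (-x)) := by
  rw [expNeg, EReal.coe_ennreal_ofReal, max_eq_left hx, ← EReal.coe_neg, EReal.exp_coe]

theorem expNeg_sum {ι : Type*} (s : Finset ι) (f : ι → ℝ≥0∞) :
    expNeg (∑ i ∈ s, f i) = ∏ i ∈ s, expNeg (f i) := by
  classical
  induction s using Finset.induction_on with
  | empty => simp
  | insert a s ha ih => rw [Finset.sum_insert ha, Finset.prod_insert ha, expNeg_add, ih]

theorem expNeg_mul_natCast (x : ℝ≥0∞) (n : ℕ) : expNeg (x * n) = expNeg x ^ n := by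
  simpa [mul_comm] using expNeg_sum (Finset.range n) fun _ => x

theorem tendsto_prod_expNeg (f : ℕ → ℝ≥0∞) :
    Tendsto (fun n => ∏ i ∈ Finset.range n, expNeg (f i)) atTop (𝓝 (expNeg (∑' i, f i))) := by
  simp_rw [← expNeg_sum]
  exact (continuous_expNeg.tendsto _).comp ENNReal.summable.hasSum.tendsto_sum_nat

theorem tendsto_lintegral_prod_expNeg {Ω : Type*} [MeasurableSpace Ω] {P : Measure Ω}
    [IsFiniteMeasure P] {g : ℕ → Ω → ℝ≥0∞} (hg : ∀ m, Measurable (g m)) :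
    Tendsto (fun n => ∫⁻ ω, ∏ m ∈ Finset.range n, expNeg (g m ω) ∂P) atTop
      (𝓝 (∫⁻ ω, expNeg (∑' m, g m ω) ∂P)) :=
  tendsto_lintegral_of_dominated_convergence (fun _ => 1) (fun n => by fun_prop)
    (fun n => ae_of_all _ fun ω => Finset.prod_le_one' fun m _ => expNeg_le_one _) (by simp)
    (ae_of_all _ fun ω => tendsto_prod_expNeg fun m => g m ω)

/-- The inverse of `expNeg` on `[0, 1]`. -/
noncomputable def negLog (x : ℝ≥0∞) : ℝ≥0∞ := (-ENNReal.log x).toENNReal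

@[fun_prop]
theorem measurable_negLog : Measurable negLog :=
  measurable_ereal_toENNReal.comp (continuous_neg.measurable.comp ENNReal.measurable_log)

theorem expNeg_negLog {x : ℝ≥0∞} (hx : x ≤ 1) : expNeg (negLog x) = x := by
  have hlog : 0 ≤ -ENNReal.log x := by
    rw [EReal.le_neg, neg_zero, ← ENNReal.log_one]
    exact ENNReal.log_monotone hx
  rw [expNeg, negLog, EReal.coe_toENNReal hlog, neg_neg, ENNReal.exp_log]

/-! ### The Laplace functional of a Poisson process -/

theorem hasSum_poisson_mul_pow (m y : ℝ) :
    HasSum (fun n : ℕ => Real.exp (-m) * m ^ n / n.factorial * y ^ n)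
      (Real.exp (-(m * (1 - y)))) := by
  have hexp := (NormedSpace.expSeries_div_hasSum_exp (m * y)).mul_left (Real.exp (-m))
  rw [← Real.exp_eq_exp_ℝ, ← Real.exp_add] at hexp
  convert! hexp using 1
  · funext n; ring
  · congr 1; ring

theorem lintegral_expNeg_mul_poissonMeasure (m : NNReal) (c : ℝ≥0∞) :
    ∫⁻ x, expNeg (c * x) ∂((poissonMeasure m).map (Nat.cast : ℕ → ℝ≥0∞))
      = expNeg (m * (1 - expNeg c)) := by
  rw [lintegral_map (f := fun x => expNeg (c * x)) (by fun_prop) .of_discrete,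
    poissonMeasure, lintegral_sum_measure]
  simp_rw [lintegral_smul_measure, lintegral_dirac, expNeg_mul_natCast]
  lift expNeg c to NNReal using expNeg_ne_top c with y hy
  have hy₁ : (y : ℝ) ≤ 1 := by exact_mod_cast hy.trans_le (expNeg_le_one c)
  have hsum := hasSum_poisson_mul_pow m y
  have hmy : (m : ℝ≥0∞) * (1 - y) = ENNReal.ofReal (m * (1 - y)) := by
    rw [ENNReal.ofReal_mul (by positivity), ENNReal.ofReal_sub _ (by positivity)]
    simp
  rw [hmy, expNeg_ofReal (mul_nonneg (by positivity) (sub_nonneg.2 hy₁)), ← hsum.tsum_eq,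
    ENNReal.ofReal_tsum_of_nonneg (fun n => by positivity) hsum.summable]
  refine tsum_congr fun n => ?_
  rw [smul_eq_mul, ENNReal.ofReal_mul (by positivity), ENNReal.ofReal_pow (by positivity),
    ENNReal.ofReal_coe_nnreal]

theorem lintegral_sum_dirac {ι S : Type*} [MeasurableSpace S] (x : ι → S) {u : S → ℝ≥0∞}
    (hu : Measurable u) :
    ∫⁻ y, u y ∂(Measure.sum fun i => Measure.dirac (x i)) = ∑' i, u (x i) := by
  rw [lintegral_sum_measure]
  exact tsum_congr fun i => lintegral_dirac' _ hu

theorem lintegral_comp_simpleFunc {S : Type*} [MeasurableSpace S] (μ : Measure S)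
    (g : SimpleFunc S ℝ≥0∞) {f : ℝ≥0∞ → ℝ≥0∞} (hf : f 0 = 0) :
    ∫⁻ x, f (g x) ∂μ = ∑ c : {c ∈ g.range | c ≠ 0}, f c * μ (g ⁻¹' {(c : ℝ≥0∞)}) := by
  have hmap := SimpleFunc.lintegral_eq_lintegral (g.map f) μ
  simp only [SimpleFunc.map_apply] at hmap
  rw [hmap, SimpleFunc.map_lintegral,
    Finset.sum_coe_sort {c ∈ g.range | c ≠ 0} (fun c => f c * μ (g ⁻¹' {c})), Finset.sum_filter]
  refine Finset.sum_congr rfl fun c _ => ?_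
  split_ifs with hc
  · rfl
  · rw [not_not.1 hc, hf, zero_mul]

theorem exists_simpleFunc_monotone_tendsto {S : Type*} [MeasurableSpace S] (Λ : Measure S)
    [SigmaFinite Λ] {u : S → ℝ≥0∞} (hu : Measurable u) : ∃ g : ℕ → SimpleFunc S ℝ≥0∞,
      (∀ n c, c ≠ 0 → Λ (g n ⁻¹' {c}) ≠ ⊤) ∧ (∀ x, Monotone fun n => g n x) ∧
      ∀ x, Tendsto (fun n => g n x) atTop (𝓝 (u x)) := by
  have hm := measurableSet_spanningSets Λ
  refine ⟨fun n => (SimpleFunc.eapprox u n).restrict (spanningSets Λ n), fun n c hc => ?_,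
    fun x n m hnm => ?_, fun x => ?_⟩
  · refine ne_top_of_le_ne_top (measure_spanningSets_lt_top Λ n).ne (measure_mono fun x hx => ?_)
    by_contra h
    simp only [Set.mem_preimage, SimpleFunc.restrict_apply _ (hm n),
      Set.indicator_of_notMem h, Set.mem_singleton_iff] at hx
    exact hc hx.symm
  · simp only [SimpleFunc.restrict_apply _ (hm _)]
    exact (Set.indicator_le_indicator_of_subset (monotone_spanningSets Λ hnm)
      (fun _ => zero_le) x).trans
        (Set.indicator_le_indicator (SimpleFunc.monotone_eapprox u hnm x))
  · have happrox : Tendsto (fun n => SimpleFunc.eapprox u n x) atTop (𝓝 (u x)) := by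
      rw [← SimpleFunc.iSup_eapprox_apply hu x]
      exact tendsto_atTop_iSup fun n m hnm => SimpleFunc.monotone_eapprox u hnm x
    refine happrox.congr' ?_
    obtain ⟨k, hk⟩ := Set.mem_iUnion.1 ((iUnion_spanningSets Λ).symm ▸ Set.mem_univ x)
    filter_upwards [eventually_ge_atTop k] with n hn
    rw [SimpleFunc.restrict_apply _ (hm n),
      Set.indicator_of_mem (monotone_spanningSets Λ hn hk)]

section Laplace

variable {Ω S T : Type*} [MeasurableSpace Ω] [MeasurableSpace S] [MeasurableSpace T]
  {P : Measure Ω}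

theorem measurable_pointCount {X : ℕ → Ω → S} (hX : ∀ m, Measurable (X m)) {B : Set S}
    (hB : MeasurableSet B) : Measurable (pointCount X B) := by
  unfold pointCount
  simp_rw [Measure.sum_apply _ hB, Measure.dirac_apply' _ hB]
  exact Measurable.tsum fun m => (measurable_one.indicator hB).comp (hX m)

theorem lintegral_comp_prodMk_of_indepFun [IsFiniteMeasure P] {Y : Ω → S} {Z : Ω → T}
    (hY : Measurable Y) (hZ : Measurable Z) (hYZ : IndepFun Y Z P) {F : S × T → ℝ≥0∞}
    (hF : Measurable F) :
    ∫⁻ ω, F (Y ω, Z ω) ∂P = ∫⁻ ω, ∫⁻ t, F (Y ω, t) ∂P.map Z ∂P := by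
  rw [← lintegral_map hF (hY.prodMk hZ),
    (indepFun_iff_map_prod_eq_prod_map_map hY.aemeasurable hZ.aemeasurable).1 hYZ,
    lintegral_prod _ hF.aemeasurable, lintegral_map hF.lintegral_prod_right' hY]

theorem lintegral_prod_eq_lintegral_prod_lintegral_mark [IsFiniteMeasure P] {ι : Type*}
    {X : ι → Ω → S} (hX : ∀ i, Measurable (X i)) {M : ι → Ω → T} {ν : Measure T}
    (hM : ∀ i, Measurable (M i)) (hν : ∀ i, HasLaw (M i) ν P) (hMi : iIndepFun M P)
    (hXM : IndepFun (fun ω i => X i ω) (fun ω i => M i ω) P) {k : S → T → ℝ≥0∞}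
    (hk : Measurable (Function.uncurry k)) (s : Finset ι) :
    ∫⁻ ω, ∏ i ∈ s, k (X i ω) (M i ω) ∂P = ∫⁻ ω, ∏ i ∈ s, ∫⁻ t, k (X i ω) t ∂ν ∂P := by
  have hXm : Measurable fun ω i => X i ω := measurable_pi_lambda _ hX
  have hMm : Measurable fun ω i => M i ω := measurable_pi_lambda _ hM
  have hF : Measurable fun z : (ι → S) × (ι → T) => ∏ i ∈ s, k (z.1 i) (z.2 i) := by fun_prop
  rw [lintegral_comp_prodMk_of_indepFun hXm hMm hXM hF]
  refine lintegral_congr fun ω => ?_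
  have hki (i : ι) : Measurable (k (X i ω)) := by fun_prop
  rw [lintegral_map (by fun_prop) hMm, lintegral_prod_eq_prod_lintegral_of_indepFun s
    (fun i ω' => k (X i ω) (M i ω')) (hMi.comp (fun i => k (X i ω)) hki)
    fun i => (hki i).comp (hM i)]
  exact Finset.prod_congr rfl fun i _ => (hν i).lintegral_comp (hki i).aemeasurable

namespace IsPoissonPointProcess

variable {X : ℕ → Ω → S} {Λ : Measure S}

theorem lintegral_expNeg_sum_mul_pointCount (hX : IsPoissonPointProcess X Λ P) {ι : Type*}
    [Fintype ι] (c : ι → ℝ≥0∞) {B : ι → Set S} (hB : ∀ i, MeasurableSet (B i))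
    (hΛ : ∀ i, Λ (B i) ≠ ⊤) (hd : Pairwise (Function.onFun Disjoint B)) :
    ∫⁻ ω, expNeg (∑ i, c i * pointCount X (B i) ω) ∂P
      = expNeg (∑ i, (1 - expNeg (c i)) * Λ (B i)) := by
  have hindep : iIndepFun (fun i => pointCount X (B i)) P := by
    let e := Fintype.equivFin ι
    have := hX.indep_count _ (B ∘ e.symm) (fun i => hB _) (fun i => hΛ _)
      (hd.comp_of_injective e.symm.injective)
    simpa using this.precomp e.injective
  simp_rw [expNeg_sum]
  rw [lintegral_prod_eq_prod_lintegral_of_indepFun Finset.univ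
    (fun i ω => expNeg (c i * pointCount X (B i) ω))
    (hindep.comp (fun i x => expNeg (c i * x)) fun i => by fun_prop)
    fun i => measurable_expNeg.comp ((measurable_pointCount hX.measurable (hB i)).const_mul _)]
  refine Finset.prod_congr rfl fun i _ => ?_
  rw [(hX.count_law (B i) (hB i) (hΛ i)).lintegral_comp (f := fun x => expNeg (c i * x))
    (by fun_prop), lintegral_expNeg_mul_poissonMeasure, ENNReal.coe_toNNReal (hΛ i), mul_comm]

theorem lintegral_expNeg_simpleFunc (hX : IsPoissonPointProcess X Λ P) (g : SimpleFunc S ℝ≥0∞)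
    (hg : ∀ c, c ≠ 0 → Λ (g ⁻¹' {c}) ≠ ⊤) :
    ∫⁻ ω, expNeg (∑' m, g (X m ω)) ∂P = expNeg (∫⁻ x, 1 - expNeg (g x) ∂Λ) := by
  simp_rw [← lintegral_sum_dirac (fun m => X m _) g.measurable]
  rw [lintegral_comp_simpleFunc Λ g (f := fun c => 1 - expNeg c) (by simp),
    ← hX.lintegral_expNeg_sum_mul_pointCount
      (fun c : {c ∈ g.range | c ≠ 0} => (c : ℝ≥0∞)) (fun c => g.measurableSet_fiber _)
      (fun c => hg c (Finset.mem_filter.1 c.2).2) fun c c' hcc' =>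
        Disjoint.preimage _ (Set.disjoint_singleton.2 (Subtype.coe_injective.ne hcc'))]
  refine lintegral_congr fun ω => congrArg expNeg ?_
  exact lintegral_comp_simpleFunc _ g (f := fun c => c) rfl

theorem lintegral_expNeg [IsFiniteMeasure P] [SigmaFinite Λ] (hX : IsPoissonPointProcess X Λ P)
    {u : S → ℝ≥0∞} (hu : Measurable u) :
    ∫⁻ ω, expNeg (∑' m, u (X m ω)) ∂P = expNeg (∫⁻ x, 1 - expNeg (u x) ∂Λ) := by
  have hXm := hX.measurable
  obtain ⟨g, hgf, hgm, hgt⟩ := exists_simpleFunc_monotone_tendsto Λ hu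
  have hl : Tendsto (fun n => ∫⁻ ω, expNeg (∑' m, g n (X m ω)) ∂P) atTop
      (𝓝 (∫⁻ ω, expNeg (∑' m, u (X m ω)) ∂P)) := by
    refine tendsto_lintegral_of_dominated_convergence (fun _ => 1) (fun n => ?_)
      (fun n => ae_of_all _ fun ω => expNeg_le_one _) (by simp) (ae_of_all _ fun ω => ?_)
    · exact measurable_expNeg.comp (Measurable.tsum fun m => (g n).measurable.comp (hXm m))
    · refine (continuous_expNeg.tendsto _).comp ?_
      simp_rw [← lintegral_sum_dirac (fun m => X m ω) hu,
        ← lintegral_sum_dirac (fun m => X m ω) (g _).measurable]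
      exact lintegral_tendsto_of_tendsto_of_monotone (fun n => (g n).measurable.aemeasurable)
        (ae_of_all _ hgm) (ae_of_all _ hgt)
  have hr : Tendsto (fun n => expNeg (∫⁻ x, 1 - expNeg (g n x) ∂Λ)) atTop
      (𝓝 (expNeg (∫⁻ x, 1 - expNeg (u x) ∂Λ))) := by
    refine (continuous_expNeg.tendsto _).comp ?_
    refine lintegral_tendsto_of_tendsto_of_monotone (fun n => ?_) (ae_of_all _ fun x => ?_)
      (ae_of_all _ fun x => ?_)
    · exact (measurable_const.sub (measurable_expNeg.comp (g n).measurable)).aemeasurable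
    · exact fun n m hnm => tsub_le_tsub_left (expNeg_antitone (hgm x hnm)) _
    · exact ENNReal.Tendsto.sub tendsto_const_nhds
        ((continuous_expNeg.tendsto _).comp (hgt x)) (Or.inl ENNReal.one_ne_top)
  exact tendsto_nhds_unique hl
    (hr.congr fun n => (hX.lintegral_expNeg_simpleFunc (g n) (hgf n)).symm)

/- Integrating out the marks replaces `expNeg (h x t)` by its mean over `t`, which is again of the
form `expNeg (u x)` with `u = negLog ∘ mean`, so the unmarked formula applies. -/
theorem lintegral_expNeg_marked [IsFiniteMeasure P] [SigmaFinite Λ]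
    (hX : IsPoissonPointProcess X Λ P) {M : ℕ → Ω → T} {ν : Measure T} [IsProbabilityMeasure ν]
    (hM : ∀ m, Measurable (M m)) (hν : ∀ m, HasLaw (M m) ν P) (hMi : iIndepFun M P)
    (hXM : IndepFun (fun ω m => X m ω) (fun ω m => M m ω) P) {h : S → T → ℝ≥0∞}
    (hh : Measurable (Function.uncurry h)) :
    ∫⁻ ω, expNeg (∑' m, h (X m ω) (M m ω)) ∂P
      = expNeg (∫⁻ x, ∫⁻ t, 1 - expNeg (h x t) ∂ν ∂Λ) := by
  have hXm := hX.measurable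
  let φ (x : S) : ℝ≥0∞ := ∫⁻ t, expNeg (h x t) ∂ν
  have hexp : Measurable (Function.uncurry fun x t => expNeg (h x t)) :=
    measurable_expNeg.comp hh
  have hφ : Measurable φ := hexp.lintegral_prod_right'
  have hφ₁ (x : S) : φ x ≤ 1 :=
    (lintegral_mono fun t => expNeg_le_one _).trans (by simp)
  have hleft := tendsto_lintegral_prod_expNeg (P := P) (g := fun m ω => h (X m ω) (M m ω))
    fun m => by fun_prop
  have hright := tendsto_lintegral_prod_expNeg (P := P) (g := fun m ω => negLog (φ (X m ω)))
    fun m => by fun_prop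
  simp_rw [lintegral_prod_eq_lintegral_prod_lintegral_mark hXm hM hν hMi hXM hexp] at hleft
  simp_rw [expNeg_negLog (hφ₁ _)] at hright
  rw [tendsto_nhds_unique hleft hright,
    hX.lintegral_expNeg (u := fun x => negLog (φ x)) (by fun_prop)]
  refine congrArg expNeg (lintegral_congr fun x => ?_)
  rw [expNeg_negLog (hφ₁ x), lintegral_sub (by fun_prop)
    (ne_top_of_le_ne_top ENNReal.one_ne_top (hφ₁ x)) (ae_of_all _ fun t => expNeg_le_one _)]
  simp [φ]

end IsPoissonPointProcess

end Laplace

/-! ### Rayleigh fading -/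

theorem setLIntegral_Ioi_mul_exp_neg_mul_sq {β a : ℝ} (hβ : 0 < β) (ha : 0 ≤ a) :
    ∫⁻ x in Set.Ioi a, ENNReal.ofReal (x * Real.exp (-β * x ^ 2))
      = ENNReal.ofReal (Real.exp (-β * a ^ 2) / (2 * β)) := by
  have hd : ∀ x ∈ Set.Ici a, HasDerivAt (fun x => -(Real.exp (-β * x ^ 2) / (2 * β)))
      (x * Real.exp (-β * x ^ 2)) x := fun x _ => by
    have hsq : HasDerivAt (fun x : ℝ => -β * x ^ 2) (-β * (2 * x)) x := by
      simpa using (hasDerivAt_pow 2 x).const_mul (-β)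
    refine (hsq.exp.div_const (2 * β)).neg.congr_deriv ?_
    field_simp
  have hpos : ∀ x ∈ Set.Ioi a, 0 ≤ x * Real.exp (-β * x ^ 2) := fun x hx =>
    mul_nonneg (ha.trans (le_of_lt hx)) (Real.exp_nonneg _)
  have hlim : Tendsto (fun x : ℝ => -(Real.exp (-β * x ^ 2) / (2 * β))) atTop (𝓝 0) := by
    have hsq : Tendsto (fun x : ℝ => -β * x ^ 2) atTop atBot :=
      (tendsto_pow_atTop two_ne_zero).const_mul_atTop_of_neg (neg_lt_zero.2 hβ)
    simpa using ((Real.tendsto_exp_atBot.comp hsq).div_const (2 * β)).neg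
  rw [← ofReal_integral_eq_lintegral_ofReal (integrableOn_Ioi_deriv_of_nonneg' hd hpos hlim)
    (ae_restrict_of_forall_mem measurableSet_Ioi hpos),
    integral_Ioi_of_hasDerivAt_of_nonneg' hd hpos hlim, zero_sub, neg_neg]

section Rayleigh

variable {s : ℝ}

theorem lintegral_rayleigh (s : ℝ) {f : ℝ → ℝ≥0∞} (hf : Measurable f) :
    ∫⁻ x, f x ∂rayleigh s = ENNReal.ofReal (1 / s ^ 2) *
      ∫⁻ x in Set.Ioi 0, ENNReal.ofReal (x * Real.exp (-(1 / (2 * s ^ 2)) * x ^ 2)) * f x := by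
  have hm : Measurable fun x : ℝ =>
      ENNReal.ofReal (if 0 ≤ x then x / s ^ 2 * Real.exp (-x ^ 2 / (2 * s ^ 2)) else 0) :=
    ENNReal.measurable_ofReal.comp
      (Measurable.ite measurableSet_Ici (by fun_prop) measurable_const)
  rw [rayleigh, lintegral_withDensity_eq_lintegral_mul _ hm hf,
    ← lintegral_const_mul _ (by fun_prop), ← lintegral_indicator measurableSet_Ioi]
  refine lintegral_congr fun x => ?_
  simp only [Pi.mul_apply, Set.indicator_apply, Set.mem_Ioi]
  rcases lt_trichotomy x 0 with hx | hx | hx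
  · simp [hx.not_ge, hx.not_gt]
  · simp [hx]
  · rw [if_pos hx.le, if_pos hx, ← mul_assoc, ← ENNReal.ofReal_mul (by positivity)]
    ring_nf

theorem ae_rayleigh_pos (s : ℝ) : ∀ᵐ x ∂rayleigh s, 0 < x := by
  change rayleigh s (Set.Ioi 0)ᶜ = 0
  rw [← lintegral_indicator_one measurableSet_Ioi.compl,
    lintegral_rayleigh s (measurable_one.indicator measurableSet_Ioi.compl)]
  refine mul_eq_zero_of_right _ ((setLIntegral_congr_fun measurableSet_Ioi fun x hx => ?_).trans
    lintegral_zero)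
  simp [Set.mem_Ioi.1 hx]

theorem rayleigh_Ioi (hs : s ≠ 0) {a : ℝ} (ha : 0 ≤ a) :
    rayleigh s (Set.Ioi a) = ENNReal.ofReal (Real.exp (-(a ^ 2 / (2 * s ^ 2)))) := by
  have hind (x : ℝ) : ENNReal.ofReal (x * Real.exp (-(1 / (2 * s ^ 2)) * x ^ 2)) *
      (Set.Ioi a).indicator 1 x = (Set.Ioi a).indicator
        (fun x => ENNReal.ofReal (x * Real.exp (-(1 / (2 * s ^ 2)) * x ^ 2))) x := by
    simp [Set.indicator_apply]
  rw [← lintegral_indicator_one measurableSet_Ioi,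
    lintegral_rayleigh s (measurable_one.indicator measurableSet_Ioi)]
  simp_rw [hind]
  rw [setLIntegral_indicator measurableSet_Ioi, Set.Ioi_inter_Ioi, max_eq_left ha,
    setLIntegral_Ioi_mul_exp_neg_mul_sq (by positivity) ha, ← ENNReal.ofReal_mul (by positivity)]
  congr 1
  field_simp

theorem isProbabilityMeasure_rayleigh (hs : s ≠ 0) : IsProbabilityMeasure (rayleigh s) := by
  refine ⟨?_⟩
  rw [← measure_congr (eventuallyEq_univ.2 (ae_rayleigh_pos s))]
  change rayleigh s (Set.Ioi 0) = 1
  simpa using rayleigh_Ioi hs le_rfl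

theorem lintegral_expNeg_rayleigh (hs : s ≠ 0) {k : ℝ} (hk : 0 ≤ k) :
    ∫⁻ x, expNeg (ENNReal.ofReal (k * x ^ 2)) ∂rayleigh s
      = ENNReal.ofReal (1 / (1 + 2 * s ^ 2 * k)) := by
  have hexp (x : ℝ) : ENNReal.ofReal (x * Real.exp (-(1 / (2 * s ^ 2)) * x ^ 2)) *
      expNeg (ENNReal.ofReal (k * x ^ 2))
      = ENNReal.ofReal (x * Real.exp (-(1 / (2 * s ^ 2) + k) * x ^ 2)) := by
    rw [expNeg_ofReal (by positivity), ← ENNReal.ofReal_mul' (Real.exp_nonneg _), mul_assoc,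
      ← Real.exp_add]
    ring_nf
  rw [lintegral_rayleigh s (f := fun x => expNeg (ENNReal.ofReal (k * x ^ 2))) (by fun_prop)]
  simp_rw [hexp]
  rw [setLIntegral_Ioi_mul_exp_neg_mul_sq (by positivity) le_rfl,
    ← ENNReal.ofReal_mul (by positivity)]
  congr 1
  simp only [ne_eq, OfNat.ofNat_ne_zero, not_false_eq_true, zero_pow, mul_zero, Real.exp_zero]
  field_simp

theorem lintegral_one_sub_expNeg_rayleigh (hs : s ≠ 0) {k : ℝ} (hk : 0 ≤ k) :
    ∫⁻ x, 1 - expNeg (ENNReal.ofReal (k * x ^ 2)) ∂rayleigh s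
      = ENNReal.ofReal (1 - 1 / (1 + 2 * s ^ 2 * k)) := by
  have := isProbabilityMeasure_rayleigh hs
  have hval := lintegral_expNeg_rayleigh hs hk
  rw [lintegral_sub (by fun_prop) (hval ▸ ENNReal.ofReal_ne_top)
    (ae_of_all _ fun x => expNeg_le_one _), hval, lintegral_one, measure_univ,
    ENNReal.ofReal_sub _ (by positivity), ENNReal.ofReal_one]

theorem rayleigh_ofReal_lt_div (hs : s ≠ 0) {θ D : ℝ} (hθ : 0 < θ) (hD : 0 < D) (i : ℝ≥0∞) :
    rayleigh s {x | ENNReal.ofReal θ < ENNReal.ofReal (D * x ^ 2) / i}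
      = expNeg (ENNReal.ofReal (θ / (2 * s ^ 2 * D)) * i) := by
  rcases eq_or_ne i ⊤ with rfl | hi
  · rw [ENNReal.mul_top (by simpa using by positivity), expNeg_top]
    simp
  obtain ⟨y, hy, rfl⟩ : ∃ y : ℝ, 0 ≤ y ∧ i = ENNReal.ofReal y :=
    ⟨i.toReal, ENNReal.toReal_nonneg, (ENNReal.ofReal_toReal hi).symm⟩
  have hset : {x | ENNReal.ofReal θ < ENNReal.ofReal (D * x ^ 2) / ENNReal.ofReal y}
      =ᵐ[rayleigh s] Set.Ioi √(θ * y / D) := by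
    filter_upwards [ae_rayleigh_pos s] with x hx
    refine propext ?_
    change ENNReal.ofReal θ < ENNReal.ofReal (D * x ^ 2) / ENNReal.ofReal y ↔ √(θ * y / D) < x
    rcases hy.eq_or_lt with rfl | hy
    · simp only [ENNReal.ofReal_zero, mul_zero, zero_div, Real.sqrt_zero, hx, iff_true]
      rw [ENNReal.div_zero (by simpa using by positivity)]
      exact ENNReal.ofReal_lt_top
    · rw [← ENNReal.ofReal_div_of_pos hy, ENNReal.ofReal_lt_ofReal_iff (by positivity),
        Real.sqrt_lt' hx, lt_div_iff₀ hy, div_lt_iff₀ hD, mul_comm D]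
  rw [measure_congr hset, rayleigh_Ioi hs (Real.sqrt_nonneg _), Real.sq_sqrt (by positivity),
    ← ENNReal.ofReal_mul (by positivity), expNeg_ofReal (by positivity)]
  congr 3
  field_simp

end Rayleigh

/-! ### The interference integral -/

theorem setLIntegral_rpow_mul_exp_neg_mul_rpow {p q b : ℝ} (hp : 0 < p) (hq : -1 < q)
    (hb : 0 < b) :
    ∫⁻ x in Set.Ioi 0, ENNReal.ofReal (x ^ q * Real.exp (-b * x ^ p))
      = ENNReal.ofReal (b ^ (-(q + 1) / p) * (1 / p) * Real.Gamma ((q + 1) / p)) := by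
  rw [← integral_rpow_mul_exp_neg_mul_rpow hp hq hb]
  refine (ofReal_integral_eq_lintegral_ofReal (integrableOn_rpow_mul_exp_neg_mul_rpow hq hp hb)
    (ae_restrict_of_forall_mem measurableSet_Ioi fun x hx => ?_)).symm
  have : (0 : ℝ) < x := hx
  positivity

theorem setLIntegral_Ioi_exp_neg_mul {a : ℝ} (ha : 0 < a) :
    ∫⁻ v in Set.Ioi 0, ENNReal.ofReal (Real.exp (-a * v)) = ENNReal.ofReal a⁻¹ := by
  have h := setLIntegral_rpow_mul_exp_neg_mul_rpow one_pos (q := 0) (by norm_num) ha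
  simpa [Real.rpow_neg_one] using h

/- Write `1 / (K + t ^ α)` as the integral of `exp (-(K + t ^ α) v)` over `v > 0` and integrate over
`t` first; Euler's reflection formula evaluates the two Gamma factors. -/
theorem setLIntegral_rpow_div_add_rpow {α β K : ℝ} (hβ : 0 < β) (hβα : β < α) (hK : 0 < K) :
    ∫⁻ t in Set.Ioi 0, ENNReal.ofReal (t ^ (β - 1) / (K + t ^ α))
      = ENNReal.ofReal (K ^ (β / α - 1) * (Real.pi / (α * Real.sin (Real.pi * (β / α))))) := by
  have hα : 0 < α := hβ.trans hβα
  have hβα₁ : β / α < 1 := (div_lt_one hα).2 hβα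
  have : 0 ≤ Real.Gamma (β / α) := (Real.Gamma_pos_of_pos (div_pos hβ hα)).le
  have hv (t : ℝ) (ht : t ∈ Set.Ioi 0) : ENNReal.ofReal (t ^ (β - 1) / (K + t ^ α))
      = ∫⁻ v in Set.Ioi 0, ENNReal.ofReal (t ^ (β - 1) * Real.exp (-(K + t ^ α) * v)) := by
    have ht : 0 < t := ht
    simp_rw [ENNReal.ofReal_mul (show 0 ≤ t ^ (β - 1) by positivity)]
    rw [lintegral_const_mul _ (by fun_prop), setLIntegral_Ioi_exp_neg_mul (by positivity),
      ← ENNReal.ofReal_mul (by positivity), div_eq_mul_inv]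
  have ht (v : ℝ) (hv : v ∈ Set.Ioi 0) :
      ∫⁻ t in Set.Ioi 0, ENNReal.ofReal (t ^ (β - 1) * Real.exp (-(K + t ^ α) * v))
        = ENNReal.ofReal (Real.Gamma (β / α) / α) *
          ENNReal.ofReal (v ^ (-(β / α)) * Real.exp (-K * v ^ (1 : ℝ))) := by
    have hsplit (t : ℝ) : t ^ (β - 1) * Real.exp (-(K + t ^ α) * v)
        = Real.exp (-K * v) * (t ^ (β - 1) * Real.exp (-v * t ^ α)) := by
      rw [mul_left_comm, ← Real.exp_add]
      ring_nf
    simp_rw [hsplit, ENNReal.ofReal_mul (Real.exp_nonneg _)]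
    rw [lintegral_const_mul _ (by fun_prop),
      setLIntegral_rpow_mul_exp_neg_mul_rpow hα (by linarith) hv, sub_add_cancel,
      ← ENNReal.ofReal_mul (Real.exp_nonneg _), ← ENNReal.ofReal_mul (by positivity),
      Real.rpow_one, neg_div]
    ring_nf
  have hm : Measurable fun z : ℝ × ℝ =>
      ENNReal.ofReal (z.1 ^ (β - 1) * Real.exp (-(K + z.1 ^ α) * z.2)) := by fun_prop
  rw [setLIntegral_congr_fun measurableSet_Ioi hv, lintegral_lintegral_swap hm.aemeasurable,
    setLIntegral_congr_fun measurableSet_Ioi ht, lintegral_const_mul _ (by fun_prop),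
    setLIntegral_rpow_mul_exp_neg_mul_rpow one_pos (by linarith) hK,
    ← ENNReal.ofReal_mul (by positivity), div_one, div_one, neg_add_eq_sub, neg_sub,
    ← div_div Real.pi, ← div_right_comm, ← Real.Gamma_mul_Gamma_one_sub]
  ring_nf

theorem lintegral_fun_norm_addHaar {E : Type*} [NormedAddCommGroup E] [NormedSpace ℝ E]
    [FiniteDimensional ℝ E] [Nontrivial E] [MeasurableSpace E] [BorelSpace E] (μ : Measure E)
    [μ.IsAddHaarMeasure] {f : ℝ → ℝ≥0∞} (hf : Measurable f) :
    ∫⁻ x, f ‖x‖ ∂μ = Module.finrank ℝ E * μ (Metric.ball 0 1) *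
      ∫⁻ t in Set.Ioi 0, ENNReal.ofReal (t ^ (Module.finrank ℝ E - 1)) * f t := by
  have hsnd : Measurable fun z : Metric.sphere (0 : E) 1 × Set.Ioi (0 : ℝ) => f z.2 := by fun_prop
  calc ∫⁻ x, f ‖x‖ ∂μ = ∫⁻ x : ({0}ᶜ : Set E), f ‖(x : E)‖ ∂μ.comap (↑) := by
        rw [lintegral_subtype_comap (measurableSet_singleton _).compl fun x => f ‖x‖,
          restrict_compl_singleton]
    _ = ∫⁻ z, f z.2 ∂μ.toSphere.prod (.volumeIoiPow (Module.finrank ℝ E - 1)) := by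
        simpa using μ.measurePreserving_homeomorphUnitSphereProd.lintegral_comp hsnd
    _ = μ.toSphere Set.univ *
          ∫⁻ t : Set.Ioi (0 : ℝ), f t ∂.volumeIoiPow (Module.finrank ℝ E - 1) := by
        rw [lintegral_prod _ hsnd.aemeasurable]
        simp only [lintegral_const, mul_comm]
    _ = _ := by
        rw [Measure.volumeIoiPow, lintegral_withDensity_eq_lintegral_mul _ (by fun_prop)
          (by fun_prop), μ.toSphere_apply_univ]
        simp_rw [Pi.mul_apply]
        rw [lintegral_subtype_comap measurableSet_Ioi
          fun t => ENNReal.ofReal (t ^ (Module.finrank ℝ E - 1)) * f t]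

theorem sin_two_pi_div_pos {α : ℝ} (hα : 2 < α) : 0 < Real.sin (2 * Real.pi / α) := by
  refine Real.sin_pos_of_pos_of_lt_pi (by positivity) ?_
  rw [div_lt_iff₀ (by positivity), mul_comm]
  gcongr

theorem kappa_pos {α : ℝ} (hα : 2 < α) : 0 < kappa α := by
  have := sin_two_pi_div_pos hα
  unfold kappa
  positivity

theorem lamMax_pos {d θ α : ℝ} (hd : 0 < d) (hθ : 0 < θ) (hα : 2 < α) : 0 < lamMax d θ α := by
  have := kappa_pos hα
  unfold lamMax
  positivity

theorem lintegral_plane_one_sub_one_div {α K : ℝ} (hα : 2 < α) (hK : 0 < K) (a : Plane) :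
    ∫⁻ x : Plane, ENNReal.ofReal (1 - 1 / (1 + K * dist a x ^ (-α)))
      = ENNReal.ofReal (K ^ (2 / α) * kappa α) := by
  have hpolar (t : ℝ) (ht : t ∈ Set.Ioi 0) :
      ENNReal.ofReal (t ^ (2 - 1)) * ENNReal.ofReal (1 - 1 / (1 + K * t ^ (-α)))
        = ENNReal.ofReal K * ENNReal.ofReal (t ^ ((2 : ℝ) - 1) / (K + t ^ α)) := by
    have ht : 0 < t := ht
    have : 0 < t ^ α := by positivity
    rw [← ENNReal.ofReal_mul (by positivity), ← ENNReal.ofReal_mul hK.le, Real.rpow_neg ht.le]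
    congr 1
    rw [show (2 : ℝ) - 1 = 1 by norm_num, Real.rpow_one, pow_one]
    field_simp
    ring
  simp_rw [dist_eq_norm]
  rw [lintegral_sub_left_eq_self
      (fun x : Plane => ENNReal.ofReal (1 - 1 / (1 + K * ‖x‖ ^ (-α)))) a,
    lintegral_fun_norm_addHaar volume
      (f := fun t => ENNReal.ofReal (1 - 1 / (1 + K * t ^ (-α)))) (by fun_prop),
    finrank_euclideanSpace_fin, setLIntegral_congr_fun measurableSet_Ioi hpolar,
    lintegral_const_mul _ (by fun_prop), setLIntegral_rpow_div_add_rpow two_pos hα hK,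
    EuclideanSpace.volume_ball_fin_two, Real.rpow_sub_one hK.ne', ← ENNReal.ofReal_mul hK.le,
    ENNReal.ofReal_one, one_pow, one_mul, Nat.cast_ofNat, ← ENNReal.ofReal_ofNat,
    ← ENNReal.ofReal_mul (by positivity), ← ENNReal.ofReal_mul (by positivity)]
  congr 1
  rw [kappa, mul_div_assoc' Real.pi 2 α, mul_comm Real.pi 2]
  field_simp

/-! ### The interference power -/

/-- The mark of a packet: its transmitter is not in back-off, has energy, and the modulus of its
fading coefficient. -/
abbrev Mark := Bool × Bool × ℝ

/-- The law of a mark with back-off probability `b`, energy availability `r` and Rayleigh fading of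
scale `s`. -/
noncomputable def markLaw (b r : unitInterval) (s : ℝ) : Measure Mark :=
  (bernoulliMeasure true false (unitInterval.symm b)).prod
    ((bernoulliMeasure true false r).prod (rayleigh s))

open Classical in
/-- The power received at `a` at time `0` from a packet with transmitter location and arrival time
`x` and mark `t`. -/
noncomputable def markedPower (a : Plane) (L α : ℝ) (x : Plane × ℝ) (t : Mark) : ℝ≥0∞ :=
  if x.2 ∈ Set.Ioc (-L) 0 ∧ t.1 = true ∧ t.2.1 = true then
    ENNReal.ofReal (dist a x.1 ^ (-α) * t.2.2 ^ 2)
  else 0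

theorem bernoulliMeasure_singleton_true (a : unitInterval) :
    bernoulliMeasure true false a {true} = ENNReal.ofReal a := by
  rw [bernoulliMeasure_apply_of_mem_of_notMem a (.singleton _) (by simp) (by simp),
    ← unitInterval.coe_toNNReal, ENNReal.ofReal_coe_nnreal]

theorem isProbabilityMeasure_markLaw (b r : unitInterval) {s : ℝ} (hs : s ≠ 0) :
    IsProbabilityMeasure (markLaw b r s) := by
  have := isProbabilityMeasure_rayleigh hs
  unfold markLaw
  infer_instance

@[fun_prop]
theorem measurable_markedPower (a : Plane) (L α : ℝ) :
    Measurable (Function.uncurry (markedPower a L α)) := by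
  have harrival : Measurable fun z : (Plane × ℝ) × Mark => z.1.2 := by fun_prop
  have hclear : Measurable fun z : (Plane × ℝ) × Mark => z.2.1 := by fun_prop
  have hcharged : Measurable fun z : (Plane × ℝ) × Mark => z.2.2.1 := by fun_prop
  exact Measurable.ite ((harrival measurableSet_Ioc).inter
    ((hclear (.singleton true)).inter (hcharged (.singleton true)))) (by fun_prop) measurable_const

theorem one_sub_expNeg_markedPower {c : ℝ} (hc : 0 ≤ c) (a : Plane) (L α : ℝ) (x : Plane × ℝ)
    (t : Mark) :
    1 - expNeg (ENNReal.ofReal c * markedPower a L α x t)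
      = (Set.Ioc (-L) 0).indicator 1 x.2 * (({true} : Set Bool).indicator 1 t.1 *
        (({true} : Set Bool).indicator 1 t.2.1 *
          (1 - expNeg (ENNReal.ofReal (c * dist a x.1 ^ (-α) * t.2.2 ^ 2))))) := by
  by_cases h : x.2 ∈ Set.Ioc (-L) 0 ∧ t.1 = true ∧ t.2.1 = true
  · obtain ⟨hx, hclear, hcharged⟩ := h
    simp [markedPower, hx, hclear, hcharged, ← ENNReal.ofReal_mul hc, mul_assoc]
  · rw [markedPower, if_neg h, mul_zero, expNeg_zero, tsub_self]
    simp only [Set.indicator_apply, Set.mem_singleton_iff]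
    grind

theorem lintegral_one_sub_expNeg_markedPower (b r : unitInterval) {s c : ℝ} (hs : s ≠ 0)
    (hc : 0 ≤ c) (a : Plane) (L α : ℝ) (x : Plane × ℝ) :
    ∫⁻ t, 1 - expNeg (ENNReal.ofReal c * markedPower a L α x t) ∂markLaw b r s
      = ENNReal.ofReal ((1 - b) * r) *
          ENNReal.ofReal (1 - 1 / (1 + 2 * s ^ 2 * c * dist a x.1 ^ (-α))) *
        (Set.Ioc (-L) 0).indicator 1 x.2 := by
  have := isProbabilityMeasure_rayleigh hs
  have hfade : Measurable fun y : ℝ =>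
      1 - expNeg (ENNReal.ofReal (c * dist a x.1 ^ (-α) * y ^ 2)) := by fun_prop
  have htrue : Measurable (({true} : Set Bool).indicator (1 : Bool → ℝ≥0∞)) :=
    measurable_one.indicator (.singleton _)
  simp_rw [one_sub_expNeg_markedPower hc]
  rw [lintegral_const_mul _ (by fun_prop), markLaw,
    lintegral_prod_mul (g := fun y : Bool × ℝ => ({true} : Set Bool).indicator 1 y.1 *
      (1 - expNeg (ENNReal.ofReal (c * dist a x.1 ^ (-α) * y.2 ^ 2))))
      htrue.aemeasurable (by fun_prop),
    lintegral_prod_mul htrue.aemeasurable hfade.aemeasurable,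
    lintegral_indicator_one (.singleton _), lintegral_indicator_one (.singleton _),
    bernoulliMeasure_singleton_true, bernoulliMeasure_singleton_true,
    lintegral_one_sub_expNeg_rayleigh hs (by positivity), unitInterval.coe_symm_eq,
    ENNReal.ofReal_mul (sub_nonneg.2 b.2.2), ← mul_assoc (2 * s ^ 2)]
  ring

theorem lintegral_lintegral_one_sub_expNeg_markedPower (b r : unitInterval) {s c α : ℝ}
    (hs : s ≠ 0) (hc : 0 < c) (hα : 2 < α) (a : Plane) (L : ℝ) :
    ∫⁻ x, ∫⁻ t, 1 - expNeg (ENNReal.ofReal c * markedPower a L α x t) ∂markLaw b r s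
      = ENNReal.ofReal ((1 - b) * r) *
        ENNReal.ofReal ((2 * s ^ 2 * c) ^ (2 / α) * kappa α) * ENNReal.ofReal L := by
  simp_rw [lintegral_one_sub_expNeg_markedPower b r hs hc.le]
  rw [Measure.volume_eq_prod,
    lintegral_prod_mul (f := fun x : Plane => ENNReal.ofReal ((1 - b) * r) *
      ENNReal.ofReal (1 - 1 / (1 + 2 * s ^ 2 * c * dist a x ^ (-α)))) (by fun_prop)
      (measurable_one.indicator measurableSet_Ioc).aemeasurable,
    lintegral_const_mul _ (by fun_prop),
    lintegral_plane_one_sub_one_div hα (by positivity), lintegral_indicator_one measurableSet_Ioc,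
    Real.volume_Ioc, zero_sub, neg_neg]

/-! ### The success probability -/

namespace Network

variable {Ω : Type*}

/-- The mark of packet `m`. -/
def mark (N : Network Ω) (m : ℕ) (ω : Ω) : Mark := (N.clear m ω, N.charged m ω, N.fade m ω)

/-- The interference power at the typical receiver at time `0`. -/
noncomputable def interference (N : Network Ω) (L α : ℝ) (ω : Ω) : ℝ≥0∞ :=
  ∑' m, N.receivedPower L α m ω

namespace HasIndependentBackoffs

variable [MeasurableSpace Ω] {P : Measure Ω} {lam L d s α θ : ℝ} {b r : unitInterval}
  {N : Network Ω}

theorem measurable_mark (h : N.HasIndependentBackoffs P lam L d s b r) (m : ℕ) :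
    Measurable (N.mark m) :=
  (h.measurable_clear m).prodMk ((h.measurable_charged m).prodMk (h.measurable_fade m))

theorem measurable_interference (h : N.HasIndependentBackoffs P lam L d s b r) :
    Measurable (N.interference L α) :=
  Measurable.tsum fun m => (measurable_markedPower N.rx L α).comp
    ((h.packets.measurable m).prodMk (h.measurable_mark m))

theorem measurable_SIR (h : N.HasIndependentBackoffs P lam L d s b r) :
    Measurable (N.SIR L α) := by
  have := h.measurable_fade₀
  exact Measurable.div (by fun_prop) h.measurable_interference

theorem indepFun_interference_fade₀ (h : N.HasIndependentBackoffs P lam L d s b r) :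
    IndepFun (N.interference L α) N.fade₀ P := by
  have hsum : Measurable fun z : (ℕ → Plane × ℝ) × (ℕ → Mark) =>
      ∑' m, markedPower N.rx L α (z.1 m) (z.2 m) := Measurable.tsum fun m => by fun_prop
  exact h.indep_fade₀.symm.comp hsum measurable_id

theorem measure_lt_SIR_eq_lintegral [IsFiniteMeasure P]
    (h : N.HasIndependentBackoffs P lam L d s b r) (hd : 0 < d) (hs : s ≠ 0) (hθ : 0 < θ) :
    P {ω | ENNReal.ofReal θ < N.SIR L α ω}
      = ∫⁻ ω, expNeg (ENNReal.ofReal (θ / (2 * s ^ 2 * d ^ (-α))) * N.interference L α ω) ∂P := by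
  let A : Set (ℝ≥0∞ × ℝ) := {z | ENNReal.ofReal θ < ENNReal.ofReal (d ^ (-α) * z.2 ^ 2) / z.1}
  have hA : MeasurableSet A :=
    measurableSet_lt measurable_const (Measurable.div (by fun_prop) measurable_fst)
  have hevent : {ω | ENNReal.ofReal θ < N.SIR L α ω}
      = (fun ω => (N.interference L α ω, N.fade₀ ω)) ⁻¹' A := by
    simp only [SIR, h.dist_pair]
    rfl
  rw [hevent, ← lintegral_indicator_one
    ((h.measurable_interference.prodMk h.measurable_fade₀) hA)]
  refine (lintegral_comp_prodMk_of_indepFun h.measurable_interference h.measurable_fade₀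
    h.indepFun_interference_fade₀ (measurable_one.indicator hA)).trans
      (lintegral_congr fun ω => ?_)
  rw [h.fade₀_law.map_eq, ← rayleigh_ofReal_lt_div hs hθ (by positivity) (N.interference L α ω)]
  exact lintegral_indicator_one (measurable_prodMk_left hA)

theorem lintegral_expNeg_interference [IsFiniteMeasure P]
    (h : N.HasIndependentBackoffs P lam L d s b r) (hlam : 0 ≤ lam) (hL : 0 < L) (hs : s ≠ 0)
    (hα : 2 < α) {c : ℝ} (hc : 0 < c) :
    ∫⁻ ω, expNeg (ENNReal.ofReal c * N.interference L α ω) ∂P = ENNReal.ofReal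
      (Real.exp (-(lam * ((1 - b) * r) * ((2 * s ^ 2 * c) ^ (2 / α) * kappa α)))) := by
  have := isProbabilityMeasure_markLaw b r hs
  have hκ := kappa_pos hα
  have hbr : 0 ≤ (1 - (b : ℝ)) * r := mul_nonneg (sub_nonneg.2 b.2.2) r.2.1
  have hσ : SigmaFinite (ENNReal.ofReal (lam / L) • (volume : Measure (Plane × ℝ))) :=
    inferInstanceAs (SigmaFinite (Real.toNNReal (lam / L) • (volume : Measure (Plane × ℝ))))
  have hlaplace := h.packets.lintegral_expNeg_marked (M := N.mark) (ν := markLaw b r s)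
    (h := fun x t => ENNReal.ofReal c * markedPower N.rx L α x t) h.measurable_mark
    h.mark_law h.indep_marks h.indep_packets (by fun_prop)
  simp_rw [ENNReal.tsum_mul_left] at hlaplace
  refine hlaplace.trans ?_
  rw [lintegral_smul_measure, lintegral_lintegral_one_sub_expNeg_markedPower b r hs hc hα,
    smul_eq_mul, ← ENNReal.ofReal_mul hbr, ← ENNReal.ofReal_mul (by positivity),
    ← ENNReal.ofReal_mul (by positivity), expNeg_ofReal (by positivity)]
  congr 3
  field_simp

theorem measure_lt_SIR [IsFiniteMeasure P] (h : N.HasIndependentBackoffs P lam L d s b r)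
    (hlam : 0 ≤ lam) (hL : 0 < L) (hd : 0 < d) (hs : s ≠ 0) (hα : 2 < α) (hθ : 0 < θ) :
    P {ω | ENNReal.ofReal θ < N.SIR L α ω}
      = ENNReal.ofReal (Real.exp (-(lam * ((1 - b) * r) / lamMax d θ α))) := by
  have hscale : 2 * s ^ 2 * (θ / (2 * s ^ 2 * d ^ (-α))) = θ * d ^ α := by
    rw [Real.rpow_neg hd.le]
    field_simp
  have hpow : (θ * d ^ α) ^ (2 / α) = d ^ 2 * θ ^ (2 / α) := by
    rw [Real.mul_rpow hθ.le (by positivity), ← Real.rpow_mul hd.le,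
      mul_div_cancel₀ _ (by positivity), Real.rpow_two, mul_comm]
  rw [h.measure_lt_SIR_eq_lintegral hd hs hθ,
    h.lintegral_expNeg_interference hlam hL hs hα (by positivity), hscale, hpow, lamMax,
    div_div_eq_mul_div, div_one]

end HasIndependentBackoffs

theorem IsBackoffProbability.one_sub_eq [MeasurableSpace Ω] {P : Measure Ω}
    [IsProbabilityMeasure P] {lam L d s α θ p : ℝ} {e₀ : ℕ} {N : Network Ω} {b : unitInterval}
    (hb : N.IsBackoffProbability P lam L d s α θ p e₀ b) (hlam : 0 ≤ lam) (hL : 0 < L)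
    (hd : 0 < d) (hs : s ≠ 0) (hα : 2 < α) (hθ : 0 < θ) (hp : p ∈ Set.Icc 0 1) :
    1 - (b : ℝ) = Real.exp (-(lam * min p (1 - b) / lamMax d θ α)) := by
  obtain ⟨r, hr, h, hPb⟩ := hb
  have hmeas : MeasurableSet {ω | ENNReal.ofReal θ < N.SIR L α ω} :=
    measurableSet_lt measurable_const h.measurable_SIR
  have hcompl : P.real {ω | ENNReal.ofReal θ < N.SIR L α ω}ᶜ = b := hPb
  have hsuccess : P.real {ω | ENNReal.ofReal θ < N.SIR L α ω}
      = Real.exp (-(lam * ((1 - b) * r) / lamMax d θ α)) := by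
    rw [measureReal_def, h.measure_lt_SIR hlam hL hd hs hα hθ,
      ENNReal.toReal_ofReal (Real.exp_nonneg _)]
  rw [← hr.mul_eq_min hp (Set.Icc.one_sub_mem b.2), ← hsuccess, ← hcompl,
    probReal_compl_eq_one_sub hmeas, sub_sub_cancel]

end Network

/-! ### Fixed points and Lambert's function -/

theorem eq_apply_of_eq_apply_min {β : Type*} [LinearOrder β] {f : β → β} (hf : Antitone f)
    {p x : β} (hx : x = f (min p x)) (hp : p < f p) : x = f p := by
  rcases le_total p x with hpx | hxp
  · rwa [min_eq_left hpx] at hx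
  · rw [min_eq_right hxp] at hx
    exact absurd hxp (hp.trans_le (hx ▸ hf hxp)).not_ge

theorem eq_apply_self_of_eq_apply_min {β : Type*} [LinearOrder β] {f : β → β} {p x : β}
    (hx : x = f (min p x)) (hp : f p ≤ p) : x = f x := by
  rcases le_total x p with hxp | hpx
  · rwa [min_eq_right hxp] at hx
  · rw [min_eq_left hpx] at hx
    obtain rfl : p = x := le_antisymm hpx (hx.trans_le hp)
    exact hx

theorem lt_neg_mul_log_div_iff {M lam p : ℝ} (hM : 0 < M) (hlam : 0 < lam) (hp : 0 < p) :
    p < -M * Real.log p / lam ↔ p < Real.exp (-(lam * p / M)) := by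
  rw [← Real.log_lt_iff_lt_exp hp, lt_div_iff₀ hlam, lt_neg, div_lt_iff₀ hM, neg_mul,
    lt_neg, mul_comm p, mul_comm M, lt_neg, neg_mul]

theorem strictMonoOn_mul_exp : StrictMonoOn (fun w : ℝ => w * Real.exp w) (Set.Ici (-1)) := by
  refine strictMonoOn_of_deriv_pos (convex_Ici _) (by fun_prop) fun w hw => ?_
  have hw : -1 < w := by rwa [interior_Ici] at hw
  have hderiv : HasDerivAt (fun w : ℝ => w * Real.exp w) (1 * Real.exp w + w * Real.exp w) w :=
    (hasDerivAt_id w).mul (Real.hasDerivAt_exp w)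
  rw [hderiv.deriv, ← add_mul]
  exact mul_pos (by linarith) (Real.exp_pos w)

theorem exists_mul_exp_eq {y : ℝ} (hy : 0 ≤ y) :
    ∃ w ∈ Set.Ici (-1 : ℝ), w * Real.exp w = y := by
  obtain ⟨w, hw, h⟩ := intermediate_value_Icc hy
    (f := fun w : ℝ => w * Real.exp w) (by fun_prop)
    (show y ∈ Set.Icc _ _ from ⟨by simpa using hy, le_mul_of_one_le_right hy (Real.one_le_exp hy)⟩)
  exact ⟨w, le_trans (by norm_num) hw.1, h⟩

theorem lambertW₀_mul_exp {y : ℝ} (hy : 0 ≤ y) : lambertW₀ y * Real.exp (lambertW₀ y) = y :=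
  Function.invFunOn_eq (exists_mul_exp_eq hy)

theorem eq_lambertW₀ {w y : ℝ} (hw : -1 ≤ w) (hy : 0 ≤ y) (h : w * Real.exp w = y) :
    w = lambertW₀ y :=
  strictMonoOn_mul_exp.injOn hw (Function.invFunOn_mem (exists_mul_exp_eq hy))
    (h.trans (lambertW₀_mul_exp hy).symm)

theorem eq_exp_neg_mul_iff {ρ : ℝ} (hρ : 0 < ρ) (y : ℝ) :
    y = Real.exp (-(ρ * y)) ↔ ρ * y = lambertW₀ ρ := by
  have hiff : y = Real.exp (-(ρ * y)) ↔ ρ * y * Real.exp (ρ * y) = ρ := by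
    rw [Real.exp_neg, ← mul_eq_one_iff_eq_inv₀ (Real.exp_ne_zero _), mul_assoc,
      mul_eq_left₀ hρ.ne']
  refine ⟨fun h => ?_, fun h => hiff.2 (h ▸ lambertW₀_mul_exp hρ.le)⟩
  have hy : 0 < y := h ▸ Real.exp_pos _
  exact eq_lambertW₀ (by linarith [mul_pos hρ hy]) hρ.le (hiff.1 h)

theorem eq_one_sub_exp_iff {M lam : ℝ} (hM : 0 < M) (hlam : 0 < lam) (x : ℝ) :
    x = 1 - Real.exp (-(lam * (1 - x) / M)) ↔ x = 1 - M / lam * lambertW₀ (lam / M) := by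
  rw [eq_sub_iff_add_eq', ← eq_sub_iff_add_eq, eq_comm, mul_div_right_comm,
    eq_exp_neg_mul_iff (div_pos hlam hM), eq_sub_iff_add_eq', ← eq_sub_iff_add_eq, ← inv_div lam M,
    inv_mul_eq_iff_eq_mul₀ (by positivity), eq_comm]

end EnergyCSMA

theorem theorem5 {Ω : Type*} [MeasurableSpace Ω] (P : MeasureTheory.Measure Ω)
    [MeasureTheory.IsProbabilityMeasure P]
    (lam L d s α θ p : ℝ) (hlam : 0 < lam) (hL : 0 < L) (hd : 0 < d) (hs : 0 < s)
    (hα : 2 < α) (hθ : 0 < θ) (hp₀ : 0 < p) (hp₁ : p ≤ 1) (e₀ : ℕ)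
    (N : EnergyCSMA.Network Ω) (b : unitInterval)
    (hb : N.IsBackoffProbability P lam L d s α θ p e₀ b) :
    (p < -EnergyCSMA.lamMax d θ α * Real.log p / lam →
      (b : ℝ) = 1 - Real.exp (-(p * lam / EnergyCSMA.lamMax d θ α))) ∧
    (¬ p < -EnergyCSMA.lamMax d θ α * Real.log p / lam →
      (b : ℝ) = 1 - Real.exp (-(lam * (1 - b) / EnergyCSMA.lamMax d θ α)) ∧
      ∀ x : ℝ, x = 1 - Real.exp (-(lam * (1 - x) / EnergyCSMA.lamMax d θ α)) ↔
        x = 1 - EnergyCSMA.lamMax d θ α / lam *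
          EnergyCSMA.lambertW₀ (lam / EnergyCSMA.lamMax d θ α)) := by
  have hfix := hb.one_sub_eq hlam.le hL hd hs.ne' hα hθ ⟨hp₀.le, hp₁⟩
  have hM := EnergyCSMA.lamMax_pos hd hθ hα
  set M := EnergyCSMA.lamMax d θ α
  have hanti : Antitone fun y => Real.exp (-(lam * y / M)) := fun x y hxy => by
    dsimp only
    gcongr
  rw [EnergyCSMA.lt_neg_mul_log_div_iff hM hlam hp₀, not_lt]
  refine ⟨fun hp => ?_, fun hp => ⟨?_, EnergyCSMA.eq_one_sub_exp_iff hM hlam⟩⟩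
  · rw [mul_comm p, ← EnergyCSMA.eq_apply_of_eq_apply_min hanti hfix hp, sub_sub_cancel]
  · have h := EnergyCSMA.eq_apply_self_of_eq_apply_min
      (f := fun y => Real.exp (-(lam * y / M))) hfix hp
    rw [← h, sub_sub_cancel]
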